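/- Let $k$ be a field, $S=k[x,y,z]$, and let $a,b',c'\ge 0$ be integers such that the binomial $f=x^a-y^{b'}z^{c'}$ is nonzero and lies in $(x,y,z)$ (i.e. $a\ge 1$ and $b'+c'\ge 1$). Let $L\subset S$ be an ideal generated by $f$ and finitely many monomials. Suppose that $\operatorname{ht}(L)=3$ and that $L$ is Gorenstein, i.e. $S/L$ is a Gorenstein ring. Then $L$ can be generated by at most $5$ elements. More precisely, there are least integers $b,c\ge 0$ with $y^b\in L$ and $z^c\in L$, and, putting $J=(f,y^b,z^c)$, there are integers $\alpha,\beta,\gamma\ge 0$ with $\alpha<a$ such that $$L = J : x^\alpha y^\beta z^\gamma = \bigl(f,\; y^{\max(b-\beta,0)},\; z^{\max(c-\gamma,0)},\; x^{\max(a-\alpha,0)}y^{\max(b-b'-\beta,0)},\; x^{\max(a-\alpha,0)}z^{\max(c-c'-\gamma,0)}\bigr).$$ -/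

import Mathlib

open CategoryTheory MvPolynomial

universe u

/-- A commutative ring is Gorenstein if it is Noetherian and the localization at every prime ideal
has finite injective dimension as a module over itself. -/
structure IsGorensteinRing (R : Type u) [CommRing R] : Prop where
  isNoetherianRing : IsNoetherianRing R
  exists_hasInjectiveDimensionLE (p : Ideal R) [p.IsPrime] : ∃ n : ℕ,
    HasInjectiveDimensionLE
      (ModuleCat.of.{u} (Localization.AtPrime p) (Localization.AtPrime p)) n

/-- An ideal `L` of a ring `S` is Gorenstein if the quotient ring `S ⧸ L` is. -/
def IsGorensteinIdeal {S : Type u} [CommRing S] (L : Ideal S) : Prop :=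
  IsGorensteinRing (S ⧸ L)

section Binomial

variable (k : Type u) [Field k]

/-- The monomial `x ^ α * y ^ β * z ^ γ` of `k[x, y, z]`, with `x = X 0`, `y = X 1`, `z = X 2`. -/
noncomputable def xyzMonomial (α β γ : ℕ) : MvPolynomial (Fin 3) k :=
  X 0 ^ α * X 1 ^ β * X 2 ^ γ

/-- The polynomial `x ^ a - y ^ b' * z ^ c'`. -/
noncomputable def xyzBinomial (a b' c' : ℕ) : MvPolynomial (Fin 3) k :=
  X 0 ^ a - X 1 ^ b' * X 2 ^ c'

/-- The ideal `J = (x ^ a - y ^ b' * z ^ c', y ^ b, z ^ c)`. -/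
noncomputable def idealJ (a b' c' b c : ℕ) : Ideal (MvPolynomial (Fin 3) k) :=
  Ideal.span {xyzBinomial k a b' c', X 1 ^ b, X 2 ^ c}

/-- The ideal generated by the five elements
`x ^ a - y ^ b' * z ^ c'`, `y ^ max (b - β) 0`, `z ^ max (c - γ) 0`,
`x ^ max (a - α) 0 * y ^ max (b - b' - β) 0`, `x ^ max (a - α) 0 * z ^ max (c - c' - γ) 0`.
The maxima with `0` are the truncated subtraction of natural numbers. -/
noncomputable def fiveGenIdeal (a b' c' b c α β γ : ℕ) : Ideal (MvPolynomial (Fin 3) k) :=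
  Ideal.span {xyzBinomial k a b' c', X 1 ^ (b - β), X 2 ^ (c - γ),
    X 0 ^ (a - α) * X 1 ^ (b - b' - β), X 0 ^ (a - α) * X 2 ^ (c - c' - γ)}

end Binomial

/-! Height three makes `S ⧸ L` Artinian local at the origin, and the Gorenstein property makes its
socle one-dimensional (`dvd_of_mem_socle_of_hasInjectiveDimensionLE`). Modulo `f`, monomials are
identified along the lattice spanned by `(a, -b', -c')`, and each class has a representative whose
`x`-exponent is below `a`. Since `1 ∉ L` has a monomial multiple in the socle, the socle is spanned
by such a monomial `σ`. Every monomial outside `L` then divides `σ` up to congruence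
(`exists_socle_monomial`), so `σ` determines `L`. Two consequences are read off. The monomial
`x^(a-1) y^(b-1) z^(c-1)` lies outside `J`, and its quotient by `σ` is the monomial of the colon
(`eq_idealJ_colon`). The minimal ways for a normal form to fail to divide `σ` give the four monomial
generators besides `f` (`eq_span_of_socle_monomial`). -/

/-! ### Finite injective dimension and the socle of an Artinian local ring. -/

/-- The short exact sequence `0 → N → M → M / N → 0` attached to an injective linear map `N → M`. -/
theorem shortExact_mkQ_range {A : Type u} [CommRing A] {N M : Type u} [AddCommGroup N] [Module A N]
    [AddCommGroup M] [Module A M] (i : N →ₗ[A] M) (hi : Function.Injective i) :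
    (ModuleCat.shortComplexOfCompEqZero _ _ i.exact_map_mkQ_range.linearMap_comp_eq_zero).ShortExact :=
  ModuleCat.shortComplex_shortExact _ i.exact_map_mkQ_range hi (Submodule.mkQ_surjective _)

/-- A nonzero Noetherian ring has an associated prime, and here the only prime is the maximal ideal.
-/
theorem exists_embedding_residueField {A : Type u} [CommRing A] [IsLocalRing A] [IsArtinianRing A] :
    ∃ i : (A ⧸ IsLocalRing.maximalIdeal A) →ₗ[A] A, Function.Injective i := by
  obtain ⟨p, hp⟩ := associatedPrimes.nonempty A A
  have hpp : p.IsPrime := hp.isPrime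
  have := IsLocalRing.eq_maximalIdeal (hpp.isMaximal')
  subst this
  obtain ⟨f, hf⟩ := (isAssociatedPrime_iff_exists_injective_linearMap _ _).1 hp |>.2
  exact ⟨f, hf⟩

/-- Over an Artinian local ring, vanishing of `Ext ^ (n + 1) (-, A)` on finite modules descends to
vanishing of `Ext ^ n (-, A)`, as long as `n ≥ 1`. -/
theorem ext_eq_zero_of_ext_succ_eq_zero {A : Type u} [CommRing A] [IsLocalRing A] [IsArtinianRing A]
    (n : ℕ)
    (h : ∀ (N : Type u) [AddCommGroup N] [Module A N] [Module.Finite A N]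
      (e : Abelian.Ext (ModuleCat.of A N) (ModuleCat.of A A) (n + 2)), e = 0)
    (N : Type u) [AddCommGroup N] [Module A N] [Module.Finite A N]
    (e : Abelian.Ext (ModuleCat.of A N) (ModuleCat.of A A) (n + 1)) : e = 0 := by
  revert e
  refine IsNoetherianRing.induction_on_isQuotientEquivQuotientPrime A (M := N) inferInstance
    (motive := fun N _ _ _ =>
      ∀ e : Abelian.Ext (ModuleCat.of A N) (ModuleCat.of A A) (n + 1), e = 0) ?_ ?_ ?_
  · intro N _ _ _ _ e
    have : Limits.IsZero (ModuleCat.of A N) := ModuleCat.isZero_of_subsingleton _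
    rw [← e.mk₀_id_comp, this.eq_zero_of_src (𝟙 _), Abelian.Ext.mk₀_zero, Abelian.Ext.zero_comp]
  · intro N _ _ _ p φ e
    have hp : p.1 = IsLocalRing.maximalIdeal A := IsLocalRing.eq_maximalIdeal p.2.isMaximal'
    obtain ⟨i, hi⟩ : ∃ i : (A ⧸ p.1) →ₗ[A] A, Function.Injective i :=
      hp ▸ exists_embedding_residueField
    let j : N →ₗ[A] A := i ∘ₗ φ.toLinearMap
    have hj : Function.Injective j := hi.comp φ.injective
    -- In the long exact sequence of `0 → N → A → A/N → 0`, the class `e` is squeezed between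
    -- `Ext^(n+1)(A, A) = 0` and `Ext^(n+2)(A/N, A) = 0`.
    obtain ⟨x, rfl⟩ := Abelian.Ext.contravariant_sequence_exact₁ (shortExact_mkQ_range j hj)
      (ModuleCat.of A A) e (add_comm 1 (n + 1)) (h _ _)
    have : Projective (ModuleCat.of A A) :=
      (IsProjective.iff_projective A).1 inferInstance
    rw [x.eq_zero_of_projective, Abelian.Ext.comp_zero]
  · intro N₁ _ _ _ N₂ _ _ _ N₃ _ _ _ f g hf hg hfg h₁ h₃ e
    have hS : (ModuleCat.shortComplexOfCompEqZero f g hfg.linearMap_comp_eq_zero).ShortExact :=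
      ModuleCat.shortComplex_shortExact _ hfg hf hg
    obtain ⟨x, rfl⟩ := Abelian.Ext.contravariant_sequence_exact₂ hS (ModuleCat.of A A) e (h₁ _)
    rw [h₃ x, Abelian.Ext.comp_zero]

/-- The ring itself has no `Ext ^ 1` from finite modules if it is Artinian, local and of finite
injective dimension. -/
theorem ext_one_eq_zero_of_hasInjectiveDimensionLE {A : Type u} [CommRing A] [IsLocalRing A]
    [IsArtinianRing A] (n : ℕ) (h : HasInjectiveDimensionLE (ModuleCat.of.{u} A A) n)
    (N : Type u) [AddCommGroup N] [Module A N] [Module.Finite A N]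
    (e : Abelian.Ext (ModuleCat.of A N) (ModuleCat.of A A) 1) : e = 0 := by
  suffices H : ∀ m : ℕ, m ≤ n → ∀ (N : Type u) [AddCommGroup N] [Module A N] [Module.Finite A N]
      (e : Abelian.Ext (ModuleCat.of A N) (ModuleCat.of A A) (m + 1)), e = 0 from
    H 0 n.zero_le N e
  intro m hm
  induction hm using Nat.decreasingInduction with
  | self => exact fun N _ _ _ e => e.eq_zero_of_hasInjectiveDimensionLT (n + 1) le_rfl
  | of_succ _ hm ih => exact ext_eq_zero_of_ext_succ_eq_zero _ ih

/-- The socle of an Artinian local ring of finite injective dimension over itself is contained in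
the ideal generated by any of its nonzero elements. -/
theorem dvd_of_mem_socle_of_hasInjectiveDimensionLE {A : Type u} [CommRing A] [IsLocalRing A]
    [IsArtinianRing A] (n : ℕ) (h : HasInjectiveDimensionLE (ModuleCat.of.{u} A A) n) {s t : A}
    (hs0 : s ≠ 0) (hs : ∀ r ∈ IsLocalRing.maximalIdeal A, r * s = 0)
    (ht : ∀ r ∈ IsLocalRing.maximalIdeal A, r * t = 0) : s ∣ t := by
  let φ (s : A) (hs : ∀ r ∈ IsLocalRing.maximalIdeal A, r * s = 0) :
      (A ⧸ IsLocalRing.maximalIdeal A) →ₗ[A] A :=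
    Submodule.liftQ _ (LinearMap.toSpanSingleton A A s) (fun r hr => by simpa using hs r hr)
  have hinj : Function.Injective (φ s hs) := by
    rw [← LinearMap.ker_eq_bot, LinearMap.ker_eq_bot']
    intro x hx
    obtain ⟨r, rfl⟩ := Submodule.Quotient.mk_surjective _ x
    rw [Submodule.Quotient.mk_eq_zero, IsLocalRing.mem_maximalIdeal, mem_nonunits_iff]
    intro hr
    apply hs0
    have : r * s = 0 := hx
    exact (hr.mul_right_eq_zero).1 this
  -- Vanishing of `Ext^1` extends `1 ↦ t` along the embedding `1 ↦ s` to some `g : A → A`; then `t =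
  -- g s = s * g 1`.
  obtain ⟨x, hx⟩ := Abelian.Ext.contravariant_sequence_exact₁ (shortExact_mkQ_range _ hinj)
    (ModuleCat.of A A) (Abelian.Ext.mk₀ (ModuleCat.ofHom (φ t ht))) (add_comm 1 0)
    (ext_one_eq_zero_of_hasInjectiveDimensionLE n h _ _)
  obtain ⟨g, rfl⟩ := Abelian.Ext.homEquiv₀.symm.surjective x
  rw [Abelian.Ext.homEquiv₀_symm_apply, Abelian.Ext.mk₀_comp_mk₀] at hx
  have hx := Abelian.Ext.homEquiv₀.symm.injective hx
  have key := congrArg (fun f => f.hom (Submodule.Quotient.mk 1)) hx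
  have key : g.hom ((1 : A) * s) = 1 * t := key
  have h1 : g.hom s = t := by simpa using key
  refine ⟨g.hom (1 : A), ?_⟩
  rw [← h1, ← smul_eq_mul, ← map_smul]
  simp

/-- If `L` is a Gorenstein ideal whose radical is the maximal ideal `m`, then the socle of `S ⧸ L`
is generated by each of its nonzero elements. -/
theorem exists_sub_mul_mem_of_isGorensteinIdeal {S : Type u} [CommRing S] {L m : Ideal S}
    [hm : m.IsMaximal] (hLm : L.radical = m) (hG : IsGorensteinIdeal L) {s t : S}
    (hs0 : s ∉ L) (hs : ∀ r ∈ m, r * s ∈ L) (ht : ∀ r ∈ m, r * t ∈ L) :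
    ∃ r, t - r * s ∈ L := by
  have hprime (q : Ideal (S ⧸ L)) (hq : q.IsPrime) : q.comap (Ideal.Quotient.mk L) = m := by
    refine (hm.eq_of_le (Ideal.IsPrime.ne_top (hq.comap _)) ?_).symm
    rw [← hLm, (hq.comap _).radical_le_iff]
    intro x hx
    rw [Ideal.mem_comap, Ideal.Quotient.eq_zero_iff_mem.2 hx]
    exact q.zero_mem
  have huniq (q q' : Ideal (S ⧸ L)) (hq : q.IsPrime) (hq' : q'.IsPrime) : q = q' :=
    Ideal.comap_injective_of_surjective _ Ideal.Quotient.mk_surjective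
      ((hprime q hq).trans (hprime q' hq').symm)
  have hLtop : L ≠ ⊤ := fun h => hs0 (h ▸ Submodule.mem_top)
  have : Nontrivial (S ⧸ L) := Ideal.Quotient.nontrivial_iff.2 hLtop
  obtain ⟨M, hM⟩ := Ideal.exists_maximal (S ⧸ L)
  have : IsLocalRing (S ⧸ L) :=
    IsLocalRing.of_unique_max_ideal ⟨M, hM, fun q hq => huniq _ _ hq.isPrime hM.isPrime⟩
  have : IsNoetherianRing (S ⧸ L) := hG.isNoetherianRing
  have : Ring.KrullDimLE 0 (S ⧸ L) :=
    Ring.KrullDimLE.mk₀ fun q hq => huniq M q hM.isPrime hq ▸ hM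
  have : IsArtinianRing (S ⧸ L) := IsNoetherianRing.isArtinianRing_of_krullDimLE_zero
  obtain ⟨n, hn⟩ := hG.exists_hasInjectiveDimensionLE (IsLocalRing.maximalIdeal (S ⧸ L))
  -- Everything outside the maximal ideal is already a unit, so localizing changes nothing.
  let e : (S ⧸ L) ≃ₐ[S ⧸ L] Localization.AtPrime (IsLocalRing.maximalIdeal (S ⧸ L)) :=
    IsLocalization.atUnits (S ⧸ L) (IsLocalRing.maximalIdeal (S ⧸ L)).primeCompl
      (fun x hx => by simpa [Ideal.primeCompl, IsUnit.mem_submonoid_iff] using hx)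
  have hsoc (u : S) (hu : ∀ r ∈ m, r * u ∈ L) :
      ∀ r ∈ IsLocalRing.maximalIdeal (Localization.AtPrime (IsLocalRing.maximalIdeal (S ⧸ L))),
        r * e (Ideal.Quotient.mk L u) = 0 := by
    intro r hr
    obtain ⟨r, rfl⟩ := e.surjective r
    obtain ⟨r, rfl⟩ := Ideal.Quotient.mk_surjective r
    have hr' : Ideal.Quotient.mk L r ∈ IsLocalRing.maximalIdeal (S ⧸ L) := by
      rw [IsLocalRing.mem_maximalIdeal, mem_nonunits_iff] at hr ⊢
      exact fun h => hr (h.map e)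
    have hrm : r ∈ m := by
      rw [← hprime _ (IsLocalRing.maximalIdeal.isMaximal (S ⧸ L)).isPrime]
      exact hr'
    rw [← map_mul, ← map_mul, Ideal.Quotient.eq_zero_iff_mem.2 (hu r hrm), map_zero]
  have hne : e (Ideal.Quotient.mk L s) ≠ 0 := by
    rw [Ne, map_eq_zero_iff e e.injective, Ideal.Quotient.eq_zero_iff_mem]
    exact hs0
  obtain ⟨r, hr⟩ := dvd_of_mem_socle_of_hasInjectiveDimensionLE n hn hne (hsoc s hs) (hsoc t ht)
  obtain ⟨r, rfl⟩ := e.surjective r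
  obtain ⟨r, rfl⟩ := Ideal.Quotient.mk_surjective r
  rw [← map_mul, ← map_mul, e.injective.eq_iff, Ideal.Quotient.eq] at hr
  exact ⟨r, by rwa [mul_comm]⟩

/-! ### Height three: pure powers of `y` and `z` in `L`, and the radical. -/

section
variable {k : Type u} [Field k]

theorem span_xyz_eq_ker_constantCoeff :
    Ideal.span ({X 0, X 1, X 2} : Set (MvPolynomial (Fin 3) k)) =
      RingHom.ker (constantCoeff : MvPolynomial (Fin 3) k →+* k) := by
  have h : ({X 0, X 1, X 2} : Set (MvPolynomial (Fin 3) k)) = X '' Set.univ := by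
    ext p
    simp [Fin.exists_fin_succ, eq_comm]
  ext p
  rw [h, mem_ideal_span_X_image, RingHom.mem_ker, constantCoeff_eq, ← notMem_support_iff]
  constructor
  · intro H h0
    simpa using H 0 h0
  · intro H e he
    by_contra! hc
    exact H (by rwa [show e = 0 from Finsupp.ext fun i => hc i trivial] at he)

instance isMaximal_span_xyz :
    (Ideal.span ({X 0, X 1, X 2} : Set (MvPolynomial (Fin 3) k))).IsMaximal := by
  rw [span_xyz_eq_ker_constantCoeff]
  exact RingHom.ker_isMaximal_of_surjective _ fun c => ⟨C c, by simp⟩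

/-- By Krull's height theorem `(x, y, z)` has height at most 3, so a strictly smaller prime cannot
contain `L`. -/
theorem eq_span_xyz_of_isPrime_of_le {L P : Ideal (MvPolynomial (Fin 3) k)} (hht : L.height = 3)
    (hP : P.IsPrime) (hLP : L ≤ P) (hPm : P ≤ Ideal.span {X 0, X 1, X 2}) :
    P = Ideal.span {X 0, X 1, X 2} := by
  by_contra hne
  have hlt := Ideal.height_strict_mono_of_isPrime_of_isPrime (lt_of_le_of_ne hPm hne)
  have h3 : (3 : ℕ∞) ≤ P.height := hht ▸ Ideal.height_mono hLP
  have hle : (Ideal.span ({X 0, X 1, X 2} : Set (MvPolynomial (Fin 3) k))).height ≤ 3 := by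
    classical
    refine (Ideal.height_le_card_of_mem_minimalPrimes_span_finset
      (s := ({X 0, X 1, X 2} : Finset (MvPolynomial (Fin 3) k))) ?_).trans ?_
    · rw [Finset.coe_insert, Finset.coe_insert, Finset.coe_singleton,
        Ideal.minimalPrimes_eq_subsingleton_self]
      rfl
    · exact_mod_cast Finset.card_le_three
  exact absurd (hlt.trans_le hle) (not_lt.2 h3)

variable {a b' c' : ℕ} {E : Set (Fin 3 →₀ ℕ)} {L : Ideal (MvPolynomial (Fin 3) k)}

/-- A curve through the origin on which the binomial vanishes must be cut by one of the
monomial generators of an ideal of height three. -/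
theorem exists_aeval_monomial_ne_zero
    (hL : L = Ideal.span ({xyzBinomial k a b' c'} ∪ (fun e => monomial e (1 : k)) '' E))
    (hht : L.height = 3) (q : Fin 3 → Polynomial k) (hq : ∀ i, (q i).eval 0 = 0)
    (hqf : aeval q (xyzBinomial k a b' c') = 0) (hq0 : ∃ i, q i ≠ 0) :
    ∃ e ∈ E, aeval q (monomial e (1 : k)) ≠ 0 := by
  by_contra! hE
  obtain ⟨i, hi⟩ := hq0
  have hP := eq_span_xyz_of_isPrime_of_le hht (RingHom.ker_isPrime (aeval q : _ →ₐ[k] _)) ?_ ?_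
  · apply hi
    have : (X i : MvPolynomial (Fin 3) k) ∈ Ideal.span {X 0, X 1, X 2} := by
      apply Ideal.subset_span
      fin_cases i <;> simp
    rw [← hP, RingHom.mem_ker, aeval_X] at this
    exact this
  · rw [hL, Ideal.span_le]
    rintro p (rfl | ⟨e, he, rfl⟩)
    · exact hqf
    · exact hE e he
  · intro p hp
    rw [span_xyz_eq_ker_constantCoeff, RingHom.mem_ker]
    have h1 : Polynomial.eval 0 (aeval q p) = 0 := by
      rw [(RingHom.mem_ker).1 hp, Polynomial.eval_zero]
    have h2 : ((Polynomial.aeval (0 : k)).comp (aeval q : MvPolynomial (Fin 3) k →ₐ[k] _)) =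
        aeval (fun _ => 0) := by
      ext i
      simp [hq]
    have h3 := DFunLike.congr_fun h2 p
    rw [AlgHom.comp_apply, Polynomial.coe_aeval_eq_eval, h1] at h3
    simpa using h3.symm

theorem monomial_eq_xyz (e : Fin 3 →₀ ℕ) :
    (monomial e (1 : k)) = X 0 ^ e 0 * X 1 ^ e 1 * X 2 ^ e 2 := by
  rw [monomial_eq, Finsupp.prod_fintype _ _ (by simp), Fin.prod_univ_three]
  simp

/-- The powers of `x ^ a` and of `y ^ b' * z ^ c'` agree modulo the binomial. -/
theorem pow_sub_pow_mem (hf : xyzBinomial k a b' c' ∈ L) (n : ℕ) :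
    (X 0 ^ (a * n) - X 1 ^ (b' * n) * X 2 ^ (c' * n) : MvPolynomial (Fin 3) k) ∈ L := by
  have := Ideal.mem_of_dvd L
    (sub_dvd_pow_sub_pow (X 0 ^ a : MvPolynomial (Fin 3) k) (X 1 ^ b' * X 2 ^ c') n) hf
  rwa [mul_pow, ← pow_mul, ← pow_mul, ← pow_mul] at this

/-- If `c' ≠ 0`, then `f` vanishes on the `y`-axis, and a generator nonzero there is a power of `y`.
If `c' = 0`, the curve `(t^b', t^a, 0)` gives a generator `x^i y^j`; its `a`-th power becomes a
power of `y` on replacing `x^a` by `y^b'`. -/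
theorem exists_X_one_pow_mem
    (hL : L = Ideal.span ({xyzBinomial k a b' c'} ∪ (fun e => monomial e (1 : k)) '' E))
    (hht : L.height = 3) (ha : a ≠ 0) (hbc : b' ≠ 0 ∨ c' ≠ 0) :
    ∃ n, (X 1 : MvPolynomial (Fin 3) k) ^ n ∈ L := by
  have hfL : xyzBinomial k a b' c' ∈ L := hL ▸ Ideal.subset_span (Or.inl rfl)
  have hEL (e) (he : e ∈ E) : monomial e (1 : k) ∈ L :=
    hL ▸ Ideal.subset_span (Or.inr ⟨e, he, rfl⟩)
  by_cases hc : c' = 0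
  · subst hc
    obtain ⟨e, he, h⟩ := exists_aeval_monomial_ne_zero hL hht
      ![Polynomial.X ^ b', Polynomial.X ^ a, 0]
      (by intro i; fin_cases i <;> simp_all) (by simp [xyzBinomial, ← pow_mul, mul_comm])
      ⟨1, by simp⟩
    have he2 : e 2 = 0 := by
      by_contra h2
      exact h (by simp [monomial_eq_xyz, h2])
    have := hEL e he
    rw [monomial_eq_xyz, he2, pow_zero, mul_one] at this
    refine ⟨b' * e 0 + a * e 1, ?_⟩
    have h1 := L.mul_mem_left (X 1 ^ (a * e 1)) (pow_sub_pow_mem hfL (e 0))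
    have h2 := Ideal.pow_mem_of_mem L this a (Nat.pos_of_ne_zero ha)
    have h3 := L.sub_mem h2 h1
    convert h3 using 1
    rw [pow_add]
    ring
  · obtain ⟨e, he, h⟩ := exists_aeval_monomial_ne_zero hL hht ![0, Polynomial.X, 0]
      (by intro i; fin_cases i <;> simp) (by simp [xyzBinomial, ha, hc]) ⟨1, by simp⟩
    have he0 : e 0 = 0 := by
      by_contra h0
      exact h (by simp [monomial_eq_xyz, h0])
    have he2 : e 2 = 0 := by
      by_contra h2
      exact h (by simp [monomial_eq_xyz, h2])
    have := hEL e he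
    rw [monomial_eq_xyz, he0, he2, pow_zero, pow_zero, mul_one, one_mul] at this
    exact ⟨_, this⟩

theorem exists_X_two_pow_mem
    (hL : L = Ideal.span ({xyzBinomial k a b' c'} ∪ (fun e => monomial e (1 : k)) '' E))
    (hht : L.height = 3) (ha : a ≠ 0) (hbc : b' ≠ 0 ∨ c' ≠ 0) :
    ∃ n, (X 2 : MvPolynomial (Fin 3) k) ^ n ∈ L := by
  have hfL : xyzBinomial k a b' c' ∈ L := hL ▸ Ideal.subset_span (Or.inl rfl)
  have hEL (e) (he : e ∈ E) : monomial e (1 : k) ∈ L :=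
    hL ▸ Ideal.subset_span (Or.inr ⟨e, he, rfl⟩)
  by_cases hb : b' = 0
  · subst hb
    obtain ⟨e, he, h⟩ := exists_aeval_monomial_ne_zero hL hht
      ![Polynomial.X ^ c', 0, Polynomial.X ^ a]
      (by intro i; fin_cases i <;> simp_all) (by simp [xyzBinomial, ← pow_mul, mul_comm])
      ⟨2, by simp⟩
    have he1 : e 1 = 0 := by
      by_contra h1
      exact h (by simp [monomial_eq_xyz, h1])
    have := hEL e he
    rw [monomial_eq_xyz, he1, pow_zero, mul_one] at this
    refine ⟨c' * e 0 + a * e 2, ?_⟩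
    have h1 := L.mul_mem_left (X 2 ^ (a * e 2)) (pow_sub_pow_mem hfL (e 0))
    have h2 := Ideal.pow_mem_of_mem L this a (Nat.pos_of_ne_zero ha)
    have h3 := L.sub_mem h2 h1
    convert h3 using 1
    rw [pow_add]
    ring
  · obtain ⟨e, he, h⟩ := exists_aeval_monomial_ne_zero hL hht ![0, 0, Polynomial.X]
      (by intro i; fin_cases i <;> simp) (by simp [xyzBinomial, ha, hb]) ⟨2, by simp⟩
    have he0 : e 0 = 0 := by
      by_contra h0
      exact h (by simp [monomial_eq_xyz, h0])
    have he1 : e 1 = 0 := by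
      by_contra h1
      exact h (by simp [monomial_eq_xyz, h1])
    have := hEL e he
    rw [monomial_eq_xyz, he0, he1, pow_zero, pow_zero, mul_one, one_mul] at this
    exact ⟨_, this⟩

/-- Since `x^a = f + y^b' z^c'`, nilpotency of `y` or `z` modulo `L` forces that of `x`. -/
theorem radical_eq_span_xyz (hfL : xyzBinomial k a b' c' ∈ L) (hL : L ≠ ⊤)
    (hbc : b' ≠ 0 ∨ c' ≠ 0) (hy : ∃ n, (X 1 : MvPolynomial (Fin 3) k) ^ n ∈ L)
    (hz : ∃ n, (X 2 : MvPolynomial (Fin 3) k) ^ n ∈ L) :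
    L.radical = Ideal.span {X 0, X 1, X 2} := by
  refine (isMaximal_span_xyz.eq_of_le (by rwa [Ne, Ideal.radical_eq_top]) ?_).symm
  have hx : (X 0 : MvPolynomial (Fin 3) k) ∈ L.radical := by
    rw [← Ideal.radical_idem, Ideal.mem_radical_iff]
    refine ⟨a, ?_⟩
    have h1 : (X 1 ^ b' * X 2 ^ c' : MvPolynomial (Fin 3) k) ∈ L.radical := by
      rcases hbc with h | h
      · exact Ideal.mul_mem_right _ _ (Ideal.pow_mem_of_mem _ hy _ (Nat.pos_of_ne_zero h))
      · exact Ideal.mul_mem_left _ _ (Ideal.pow_mem_of_mem _ hz _ (Nat.pos_of_ne_zero h))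
    simpa [xyzBinomial] using L.radical.add_mem (Ideal.le_radical hfL) h1
  rw [Ideal.span_le]
  rintro p (rfl | rfl | rfl)
  exacts [hx, hy, hz]

end

/-! ### Exponent vectors modulo `(a, -b', -c')`. -/

/-- The exponent vector `(i, j, l)`. -/
noncomputable def xyzExponent (i j l : ℕ) : Fin 3 →₀ ℕ :=
  Finsupp.equivFunOnFinite.symm ![i, j, l]

@[simp] theorem xyzExponent_zero (i j l : ℕ) : xyzExponent i j l 0 = i := rfl
@[simp] theorem xyzExponent_one (i j l : ℕ) : xyzExponent i j l 1 = j := rfl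
@[simp] theorem xyzExponent_two (i j l : ℕ) : xyzExponent i j l 2 = l := rfl

theorem exponent_ext {u v : Fin 3 →₀ ℕ} (h0 : u 0 = v 0) (h1 : u 1 = v 1) (h2 : u 2 = v 2) :
    u = v := by
  ext i
  fin_cases i <;> assumption

/-- Two exponent vectors differ by an integral multiple of `(a, -b', -c')`, that is, the
corresponding monomials agree modulo `x ^ a - y ^ b' * z ^ c'`. -/
def ExponentCong (a b' c' : ℕ) (u v : Fin 3 →₀ ℕ) : Prop :=
  u 0 ≡ v 0 [MOD a] ∧ a * u 1 + b' * u 0 = a * v 1 + b' * v 0 ∧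
    a * u 2 + c' * u 0 = a * v 2 + c' * v 0

namespace ExponentCong

variable {a b' c' : ℕ} {u v w : Fin 3 →₀ ℕ}

theorem refl (u : Fin 3 →₀ ℕ) : ExponentCong a b' c' u u := ⟨Nat.ModEq.refl _, rfl, rfl⟩

theorem symm (h : ExponentCong a b' c' u v) : ExponentCong a b' c' v u :=
  ⟨h.1.symm, h.2.1.symm, h.2.2.symm⟩

theorem trans (h : ExponentCong a b' c' u v) (h' : ExponentCong a b' c' v w) :
    ExponentCong a b' c' u w :=
  ⟨h.1.trans h'.1, h.2.1.trans h'.2.1, h.2.2.trans h'.2.2⟩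

/-- The cancellation direction is what later allows division by the colon monomial. -/
theorem add_right_iff (d : Fin 3 →₀ ℕ) :
    ExponentCong a b' c' (u + d) (v + d) ↔ ExponentCong a b' c' u v := by
  simp only [ExponentCong, Finsupp.add_apply, mul_add]
  refine and_congr ⟨Nat.ModEq.add_right_cancel' _, Nat.ModEq.add_right _⟩ (and_congr ?_ ?_) <;>
    constructor <;> intro h <;> linarith

theorem add_right (h : ExponentCong a b' c' u v) (d : Fin 3 →₀ ℕ) :
    ExponentCong a b' c' (u + d) (v + d) :=
  (add_right_iff d).2 h

/-- Normal form: each factor `x^a` is traded for `y^b' z^c'`. -/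
theorem exists_lt (ha : 0 < a) (u : Fin 3 →₀ ℕ) : ∃ v, ExponentCong a b' c' u v ∧ v 0 < a := by
  refine ⟨xyzExponent (u 0 % a) (u 1 + b' * (u 0 / a)) (u 2 + c' * (u 0 / a)),
    ⟨(Nat.mod_modEq _ _).symm, ?_, ?_⟩, Nat.mod_lt _ ha⟩
  · have := Nat.mod_add_div (u 0) a
    simp only [xyzExponent_zero, xyzExponent_one]
    conv_lhs => rw [← this]
    ring
  · have := Nat.mod_add_div (u 0) a
    simp only [xyzExponent_zero, xyzExponent_two]
    conv_lhs => rw [← this]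
    ring

end ExponentCong

/-! ### Monomials modulo the binomial, and the socle monomial. -/

section
variable {k : Type u} [Field k] {a b' c' : ℕ} {E : Set (Fin 3 →₀ ℕ)}
  {L : Ideal (MvPolynomial (Fin 3) k)}

theorem ExponentCong.monomial_sub_mem (ha : 0 < a) (hf : xyzBinomial k a b' c' ∈ L)
    {u v : Fin 3 →₀ ℕ} (h : ExponentCong a b' c' u v) :
    monomial u (1 : k) - monomial v 1 ∈ L := by
  wlog huv : u 0 ≤ v 0 generalizing u v
  · rw [← neg_sub]
    exact L.neg_mem (this h.symm (not_le.1 huv).le)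
  obtain ⟨h0, h1, h2⟩ := h
  obtain ⟨n, hn⟩ := (Nat.modEq_iff_dvd' huv).1 h0
  have hv : v 0 = u 0 + a * n := by omega
  have hu1 : u 1 = v 1 + b' * n := by
    apply Nat.eq_of_mul_eq_mul_left ha
    rw [hv] at h1
    linarith
  have hu2 : u 2 = v 2 + c' * n := by
    apply Nat.eq_of_mul_eq_mul_left ha
    rw [hv] at h2
    linarith
  have := L.mul_mem_left (-(X 0 ^ u 0 * X 1 ^ v 1 * X 2 ^ v 2)) (pow_sub_pow_mem hf n)
  convert this using 1
  rw [monomial_eq_xyz, monomial_eq_xyz, hv, hu1, hu2]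
  ring

theorem ExponentCong.monomial_mem_iff (ha : 0 < a) (hf : xyzBinomial k a b' c' ∈ L)
    {u v : Fin 3 →₀ ℕ} (h : ExponentCong a b' c' u v) :
    monomial u (1 : k) ∈ L ↔ monomial v (1 : k) ∈ L := by
  have := h.monomial_sub_mem ha hf
  constructor <;> intro h'
  · simpa using L.sub_mem h' this
  · simpa using L.add_mem this h'

theorem monomial_mem_of_le {u v : Fin 3 →₀ ℕ} (h : monomial u (1 : k) ∈ L) (huv : u ≤ v) :
    monomial v (1 : k) ∈ L :=
  Ideal.mem_of_dvd L (monomial_dvd_monomial.2 ⟨Or.inr huv, one_dvd _⟩) h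

theorem exponent_le {u v : Fin 3 →₀ ℕ} (h0 : u 0 ≤ v 0) (h1 : u 1 ≤ v 1) (h2 : u 2 ≤ v 2) :
    u ≤ v := by
  intro i
  fin_cases i <;> assumption

open Classical in
/-- The sum of the coefficients of the monomials that agree with that of `g` modulo
`x ^ a - y ^ b' * z ^ c'`. -/
noncomputable def classCoeff (k : Type u) [Field k] (a b' c' : ℕ) (g : Fin 3 →₀ ℕ) :
    MvPolynomial (Fin 3) k →ₗ[k] k :=
  (basisMonomials (Fin 3) k).constr k fun e => if ExponentCong a b' c' e g then 1 else 0

open Classical in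
theorem classCoeff_monomial (g e : Fin 3 →₀ ℕ) :
    classCoeff k a b' c' g (monomial e 1) = if ExponentCong a b' c' e g then 1 else 0 := by
  have := (basisMonomials (Fin 3) k).constr_basis k
    (fun e => if ExponentCong a b' c' e g then (1 : k) else 0) e
  rwa [coe_basisMonomials] at this

/-- The functional is constant on congruence classes, so it kills multiples of `f`; by `hE` it kills
multiples of the monomial generators. -/
theorem classCoeff_eq_zero_of_mem {g : Fin 3 →₀ ℕ}
    (hE : ∀ e ∈ E, ∀ d, ¬ ExponentCong a b' c' (d + e) g) {p : MvPolynomial (Fin 3) k}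
    (hp : p ∈ Ideal.span ({xyzBinomial k a b' c'} ∪ (fun e => monomial e (1 : k)) '' E)) :
    classCoeff k a b' c' g p = 0 := by
  have key (q : MvPolynomial (Fin 3) k)
      (hq : q ∈ {xyzBinomial k a b' c'} ∪ (fun e => monomial e (1 : k)) '' E) :
      classCoeff k a b' c' g ∘ₗ LinearMap.mulRight k q = 0 := by
    refine (basisMonomials (Fin 3) k).ext fun d => ?_
    simp only [coe_basisMonomials, LinearMap.comp_apply, LinearMap.mulRight_apply,
      LinearMap.zero_apply]
    rcases hq with rfl | ⟨e, he, rfl⟩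
    · have h1 : (X 0 ^ a : MvPolynomial (Fin 3) k) = monomial (xyzExponent a 0 0) 1 := by
        simp [monomial_eq_xyz]
      have h2 : (X 1 ^ b' * X 2 ^ c' : MvPolynomial (Fin 3) k) =
          monomial (xyzExponent 0 b' c') 1 := by
        simp [monomial_eq_xyz]
      have hc : ExponentCong a b' c' (d + xyzExponent a 0 0) (d + xyzExponent 0 b' c') := by
        rw [add_comm d, add_comm d]
        refine ExponentCong.add_right ⟨?_, ?_, ?_⟩ d
        · simp [Nat.ModEq]
        · simp [mul_comm]
        · simp [mul_comm]
      rw [xyzBinomial, h1, h2, mul_sub, monomial_mul, monomial_mul, one_mul, map_sub,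
        classCoeff_monomial, classCoeff_monomial, sub_eq_zero]
      classical exact if_congr ⟨hc.symm.trans, hc.trans⟩ rfl rfl
    · rw [monomial_mul, one_mul, classCoeff_monomial, if_neg (hE e he d)]
  obtain ⟨n, r, g', hg'⟩ := Submodule.mem_span_set'.1 hp
  rw [← hg', map_sum]
  exact Finset.sum_eq_zero fun i _ => LinearMap.congr_fun (key _ (g' i).2) (r i)

theorem mul_mem_of_X_mul_mem {s : MvPolynomial (Fin 3) k} (h : ∀ i, X i * s ∈ L) :
    ∀ r ∈ Ideal.span ({X 0, X 1, X 2} : Set (MvPolynomial (Fin 3) k)), r * s ∈ L := by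
  intro r hr
  have : Ideal.span ({X 0, X 1, X 2} : Set (MvPolynomial (Fin 3) k)) ≤ L.colon {s} := by
    rw [Ideal.span_le]
    rintro p (rfl | rfl | rfl) <;> exact Submodule.mem_colon_singleton.2 (h _)
  exact Submodule.mem_colon_singleton.1 (this hr)

/-- If `L` contains a power of `(x, y, z)`, every polynomial outside `L` has a monomial multiple
representing a nonzero socle element of `S ⧸ L`. -/
theorem exists_monomial_mul_mem_socle
    (hrad : L.radical = Ideal.span {X 0, X 1, X 2}) {p : MvPolynomial (Fin 3) k} (hp : p ∉ L) :
    ∃ d, monomial d 1 * p ∉ L ∧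
      ∀ r ∈ Ideal.span ({X 0, X 1, X 2} : Set (MvPolynomial (Fin 3) k)),
        r * (monomial d 1 * p) ∈ L := by
  obtain ⟨n, hn⟩ := Ideal.exists_pow_le_of_le_radical_of_fg hrad.ge
    (Submodule.fg_span (Set.toFinite _))
  have H : ∀ (n : ℕ) (p : MvPolynomial (Fin 3) k), p ∉ L →
      (∀ r ∈ Ideal.span ({X 0, X 1, X 2} : Set (MvPolynomial (Fin 3) k)) ^ n, r * p ∈ L) →
      ∃ d, monomial d 1 * p ∉ L ∧ ∀ i, X i * (monomial d 1 * p) ∈ L := by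
    intro n
    induction n with
    | zero =>
      intro p hp h
      exact absurd (h 1 (by simp)) (by simpa using hp)
    | succ n ih =>
      intro p hp h
      by_cases hX : ∀ i, X i * p ∈ L
      · exact ⟨0, by simpa using hp, by simpa using hX⟩
      · push Not at hX
        obtain ⟨i, hi⟩ := hX
        have hXi : (X i : MvPolynomial (Fin 3) k) ∈ Ideal.span {X 0, X 1, X 2} := by
          apply Ideal.subset_span
          fin_cases i <;> simp
        obtain ⟨d, hd, hd'⟩ := ih (X i * p) hi fun r hr => by
          rw [← mul_assoc]
          apply h
          rw [pow_succ]
          exact Ideal.mul_mem_mul hr hXi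
        have he : (monomial (d + Finsupp.single i 1) (1 : k)) * p = monomial d 1 * (X i * p) := by
          rw [← mul_assoc, X, monomial_mul, one_mul]
        exact ⟨d + Finsupp.single i 1, he ▸ hd, he ▸ hd'⟩
  obtain ⟨d, hd, hd'⟩ := H n p hp fun r hr => L.mul_mem_right _ (hn hr)
  exact ⟨d, hd, mul_mem_of_X_mul_mem hd'⟩

/-- The socle of the Gorenstein quotient is represented by a monomial `x ^ i * y ^ j * z ^ l` with
`i < a`, which is a multiple modulo `L` of every polynomial outside `L`, and a multiple modulo the
binomial of every monomial outside `L`. -/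
theorem exists_socle_monomial
    (hL : L = Ideal.span ({xyzBinomial k a b' c'} ∪ (fun e => monomial e (1 : k)) '' E))
    (ha : 0 < a) (hLtop : L ≠ ⊤) (hrad : L.radical = Ideal.span {X 0, X 1, X 2})
    (hG : IsGorensteinIdeal L) :
    ∃ σ : Fin 3 →₀ ℕ, σ 0 < a ∧ monomial σ (1 : k) ∉ L ∧
      (∀ p ∉ L, ∃ r, monomial σ (1 : k) - r * p ∈ L) ∧
      ∀ u, monomial u (1 : k) ∉ L → ∃ d, ExponentCong a b' c' (u + d) σ := by
  have hfL : xyzBinomial k a b' c' ∈ L := hL ▸ Ideal.subset_span (Or.inl rfl)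
  obtain ⟨σ', hσ', hsoc'⟩ := exists_monomial_mul_mem_socle hrad (p := 1)
    ((Ideal.ne_top_iff_one L).1 hLtop)
  rw [mul_one] at hσ' hsoc'
  obtain ⟨σ, hσσ, hlt⟩ := ExponentCong.exists_lt (b' := b') (c' := c') ha σ'
  have hσ : monomial σ (1 : k) ∉ L := fun h => hσ' ((hσσ.monomial_mem_iff ha hfL).2 h)
  have hsoc : ∀ r ∈ Ideal.span ({X 0, X 1, X 2} : Set (MvPolynomial (Fin 3) k)),
      r * monomial σ (1 : k) ∈ L := by
    intro r hr
    have := L.sub_mem (hsoc' r hr) (L.mul_mem_left r (hσσ.monomial_sub_mem ha hfL))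
    rwa [← mul_sub, sub_sub_cancel] at this
  refine ⟨σ, hlt, hσ, fun p hp => ?_, fun u hu => ?_⟩
  · obtain ⟨d, hd, hd'⟩ := exists_monomial_mul_mem_socle hrad hp
    obtain ⟨r, hr⟩ := exists_sub_mul_mem_of_isGorensteinIdeal hrad hG hd hd' hsoc
    exact ⟨r * monomial d 1, by rwa [mul_assoc]⟩
  · obtain ⟨d, hd, hd'⟩ := exists_monomial_mul_mem_socle hrad hu
    rw [monomial_mul, one_mul, add_comm d] at hd hd'
    refine ⟨d, ?_⟩
    obtain ⟨r, hr⟩ := exists_sub_mul_mem_of_isGorensteinIdeal hrad hG hd hd' hsoc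
    -- Since `u + d` is a socle monomial, only the constant term of `r` matters modulo `L`.
    have h0 : r - C (constantCoeff r) ∈
        Ideal.span ({X 0, X 1, X 2} : Set (MvPolynomial (Fin 3) k)) := by
      simp [span_xyz_eq_ker_constantCoeff, RingHom.mem_ker]
    have h1 := L.add_mem hr (hd' _ h0)
    have h2 : monomial σ (1 : k) - constantCoeff r • monomial (u + d) (1 : k) ∈ L := by
      convert h1 using 1
      rw [← C_mul']
      ring
    by_contra hc
    -- If `u + d` were not congruent to `σ`, this value would be 1. It is 0 because a generator
    -- dividing a monomial congruent to `σ` would put `σ` in `L`.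
    have h3 : classCoeff k a b' c' σ
        (monomial σ (1 : k) - constantCoeff r • monomial (u + d) (1 : k)) = 0 := by
      refine classCoeff_eq_zero_of_mem (E := E) (fun e he d h => hσ ?_) (hL ▸ h2)
      rw [← h.monomial_mem_iff ha hfL]
      exact monomial_mem_of_le (hL ▸ Ideal.subset_span (Or.inr ⟨e, he, rfl⟩)) le_add_self
    rw [map_sub, map_smul, classCoeff_monomial, classCoeff_monomial, if_neg hc,
      if_pos (ExponentCong.refl σ)] at h3
    simp at h3

end

/-! ### The colon ideal and the five generators. -/

section
variable {k : Type u} [Field k] {a b' c' b c : ℕ} {E : Set (Fin 3 →₀ ℕ)}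
  {L : Ideal (MvPolynomial (Fin 3) k)} {σ : Fin 3 →₀ ℕ}

theorem xyzMonomial_eq (i j l : ℕ) :
    xyzMonomial k i j l = monomial (xyzExponent i j l) 1 := by
  simp [monomial_eq_xyz, xyzMonomial]

theorem idealJ_eq : idealJ k a b' c' b c = Ideal.span ({xyzBinomial k a b' c'} ∪
    (fun e => monomial e (1 : k)) '' {xyzExponent 0 b 0, xyzExponent 0 0 c}) := by
  rw [idealJ, Set.image_pair, Set.singleton_union]
  simp [monomial_eq_xyz]

/-- A monomial congruent to the corner has `x`-exponent at least `a - 1`. Invariance of `a * u 1 +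
b' * u 0` and `a * u 2 + c' * u 0` then keeps its other exponents below `b` and `c`. -/
theorem corner_notMem_idealJ (hb : 0 < b) (hc : 0 < c) (ha : 0 < a) :
    monomial (xyzExponent (a - 1) (b - 1) (c - 1)) (1 : k) ∉ idealJ k a b' c' b c := by
  intro h
  rw [idealJ_eq] at h
  have h0 := classCoeff_eq_zero_of_mem (a := a) (b' := b') (c' := c')
    (g := xyzExponent (a - 1) (b - 1) (c - 1)) ?_ h
  · rw [classCoeff_monomial, if_pos (ExponentCong.refl _)] at h0
    exact one_ne_zero h0
  · have aux (d : ℕ) (hd : d ≡ a - 1 [MOD a]) : a - 1 ≤ d := by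
      have := Nat.mod_le d a
      rwa [hd, Nat.mod_eq_of_lt (by omega)] at this
    rintro e (rfl | rfl) d ⟨h1, h2, h3⟩
    · simp only [Finsupp.add_apply, xyzExponent_zero, xyzExponent_one, add_zero] at h1 h2
      have h4 := Nat.mul_le_mul_left b' (aux _ h1)
      obtain ⟨b, rfl⟩ := Nat.exists_eq_succ_of_ne_zero hb.ne'
      simp only [Nat.succ_sub_one] at h2
      nlinarith
    · simp only [Finsupp.add_apply, xyzExponent_zero, xyzExponent_two, add_zero] at h1 h3
      have h4 := Nat.mul_le_mul_left c' (aux _ h1)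
      obtain ⟨c, rfl⟩ := Nat.exists_eq_succ_of_ne_zero hc.ne'
      simp only [Nat.succ_sub_one] at h3
      nlinarith

theorem X_one_pow_eq (n : ℕ) :
    (X 1 : MvPolynomial (Fin 3) k) ^ n = monomial (xyzExponent 0 n 0) 1 := by
  simp [monomial_eq_xyz]

theorem X_two_pow_eq (n : ℕ) :
    (X 2 : MvPolynomial (Fin 3) k) ^ n = monomial (xyzExponent 0 0 n) 1 := by
  simp [monomial_eq_xyz]

theorem lt_of_X_one_pow_mem (hσ : monomial σ (1 : k) ∉ L)
    (hb : (X 1 : MvPolynomial (Fin 3) k) ^ b ∈ L) : σ 1 < b := by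
  by_contra! h
  rw [X_one_pow_eq] at hb
  exact hσ (monomial_mem_of_le hb (exponent_le (by simp) (by simpa) (by simp)))

theorem lt_of_X_two_pow_mem (hσ : monomial σ (1 : k) ∉ L)
    (hc : (X 2 : MvPolynomial (Fin 3) k) ^ c ∈ L) : σ 2 < c := by
  by_contra! h
  rw [X_two_pow_eq] at hc
  exact hσ (monomial_mem_of_le hc (exponent_le (by simp) (by simp) (by simpa)))

/-- `L` is the colon ideal of `J` by the monomial taking the socle monomial of `L` to that
of `J`. -/
theorem eq_idealJ_colon
    (hL : L = Ideal.span ({xyzBinomial k a b' c'} ∪ (fun e => monomial e (1 : k)) '' E))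
    (hb : (X 1 : MvPolynomial (Fin 3) k) ^ b ∈ L) (hc : (X 2 : MvPolynomial (Fin 3) k) ^ c ∈ L)
    (hσa : σ 0 < a) (hσ : monomial σ (1 : k) ∉ L)
    (hsoc : ∀ p ∉ L, ∃ r, monomial σ (1 : k) - r * p ∈ L) :
    L = (idealJ k a b' c' b c).colon
      {xyzMonomial k (a - 1 - σ 0) (b - 1 - σ 1) (c - 1 - σ 2)} := by
  have ha : 0 < a := hσa.pos
  have hfL : xyzBinomial k a b' c' ∈ L := hL ▸ Ideal.subset_span (Or.inl rfl)
  have hσb := lt_of_X_one_pow_mem hσ hb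
  have hσc := lt_of_X_two_pow_mem hσ hc
  have hfJ : xyzBinomial k a b' c' ∈ idealJ k a b' c' b c := Ideal.subset_span (by simp)
  have hyJ : monomial (xyzExponent 0 b 0) (1 : k) ∈ idealJ k a b' c' b c :=
    X_one_pow_eq (k := k) b ▸ Ideal.subset_span (by simp)
  have hzJ : monomial (xyzExponent 0 0 c) (1 : k) ∈ idealJ k a b' c' b c :=
    X_two_pow_eq (k := k) c ▸ Ideal.subset_span (by simp)
  set w := xyzExponent (a - 1 - σ 0) (b - 1 - σ 1) (c - 1 - σ 2) with hw
  have hτ : σ + w = xyzExponent (a - 1) (b - 1) (c - 1) := by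
    apply exponent_ext <;> simp [hw] <;> omega
  rw [xyzMonomial_eq, ← hw]
  have hle : L ≤ (idealJ k a b' c' b c).colon {monomial w (1 : k)} := by
    conv_lhs => rw [hL]
    rw [Ideal.span_le]
    rintro p (rfl | ⟨e, he, rfl⟩)
    · exact Submodule.mem_colon_singleton.2 (Ideal.mul_mem_right _ _ hfJ)
    · refine Submodule.mem_colon_singleton.2 ?_
      rw [smul_eq_mul, monomial_mul, one_mul]
      obtain ⟨v, hv, hva⟩ := ExponentCong.exists_lt (b' := b') (c' := c') ha (e + w)
      rw [hv.monomial_mem_iff ha hfJ]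
      -- A normal form outside `J` divides the corner `σ + w`. Cancelling `w` would make a multiple
      -- of the generator `e` congruent to `σ`.
      by_contra hvJ
      have hvb : v 1 < b := by
        by_contra! h
        exact hvJ (monomial_mem_of_le hyJ (exponent_le (by simp) (by simpa) (by simp)))
      have hvc : v 2 < c := by
        by_contra! h
        exact hvJ (monomial_mem_of_le hzJ (exponent_le (by simp) (by simp) (by simpa)))
      obtain ⟨d, hd⟩ : ∃ d, v + d = σ + w := by
        refine ⟨xyzExponent (a - 1 - v 0) (b - 1 - v 1) (c - 1 - v 2), ?_⟩
        rw [hτ]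
        apply exponent_ext <;> simp <;> omega
      have hed : ExponentCong a b' c' (e + d) σ := by
        rw [← ExponentCong.add_right_iff w, ← hd, add_right_comm]
        exact hv.add_right d
      apply hσ
      rw [← hed.monomial_mem_iff ha hfL]
      exact monomial_mem_of_le (hL ▸ Ideal.subset_span (Or.inr ⟨e, he, rfl⟩)) le_self_add
  refine le_antisymm hle fun p hp => ?_
  by_contra hpL
  obtain ⟨r, hr⟩ := hsoc p hpL
  have h1 := Ideal.add_mem _ (hle hr) (Ideal.mul_mem_left _ r hp)
  rw [sub_add_cancel, Submodule.mem_colon_singleton, smul_eq_mul, monomial_mul, one_mul, hτ] at h1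
  exact corner_notMem_idealJ (by omega) (by omega) ha h1

/-- The five generators of an ideal whose quotient has its socle generated by the monomial `σ`. -/
theorem eq_span_of_socle_monomial
    (hL : L = Ideal.span ({xyzBinomial k a b' c'} ∪ (fun e => monomial e (1 : k)) '' E))
    (hσa : σ 0 < a) (hσ : monomial σ (1 : k) ∉ L)
    (hdiv : ∀ u, monomial u (1 : k) ∉ L → ∃ d, ExponentCong a b' c' (u + d) σ) :
    L = Ideal.span {xyzBinomial k a b' c', X 1 ^ (σ 1 + 1), X 2 ^ (σ 2 + 1),
      X 0 ^ (σ 0 + 1) * X 1 ^ (σ 1 + 1 - b'), X 0 ^ (σ 0 + 1) * X 2 ^ (σ 2 + 1 - c')} := by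
  have ha : 0 < a := hσa.pos
  have hfL : xyzBinomial k a b' c' ∈ L := hL ▸ Ideal.subset_span (Or.inl rfl)
  have hy : (X 1 ^ (σ 1 + 1) : MvPolynomial (Fin 3) k) = monomial (xyzExponent 0 (σ 1 + 1) 0) 1 :=
    X_one_pow_eq _
  have hz : (X 2 ^ (σ 2 + 1) : MvPolynomial (Fin 3) k) = monomial (xyzExponent 0 0 (σ 2 + 1)) 1 :=
    X_two_pow_eq _
  have hxy : (X 0 ^ (σ 0 + 1) * X 1 ^ (σ 1 + 1 - b') : MvPolynomial (Fin 3) k) =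
      monomial (xyzExponent (σ 0 + 1) (σ 1 + 1 - b') 0) 1 := by
    simp [monomial_eq_xyz]
  have hxz : (X 0 ^ (σ 0 + 1) * X 2 ^ (σ 2 + 1 - c') : MvPolynomial (Fin 3) k) =
      monomial (xyzExponent (σ 0 + 1) 0 (σ 2 + 1 - c')) 1 := by
    simp [monomial_eq_xyz]
  rw [hy, hz, hxy, hxz]
  have hmod (d : ℕ) (hd : d ≡ σ 0 [MOD a]) : σ 0 ≤ d := by
    have := Nat.mod_le d a
    rwa [hd, Nat.mod_eq_of_lt hσa] at this
  -- The `x`-exponent strictly exceeds `σ 0`, so it must jump by a full period `a`; this costs `b'`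
  -- in `y` and `c'` in `z`.
  have hmod' (d : ℕ) (hd : σ 0 + 1 + d ≡ σ 0 [MOD a]) : σ 0 + a ≤ σ 0 + 1 + d := by
    rw [add_assoc] at hd
    have h0 : 1 + d ≡ 0 [MOD a] := Nat.ModEq.add_left_cancel' (σ 0) hd
    have := Nat.le_of_dvd (by omega) ((Nat.modEq_zero_iff_dvd).1 h0)
    omega
  apply le_antisymm
  · set I := Ideal.span {xyzBinomial k a b' c', monomial (xyzExponent 0 (σ 1 + 1) 0) (1 : k),
      monomial (xyzExponent 0 0 (σ 2 + 1)) 1, monomial (xyzExponent (σ 0 + 1) (σ 1 + 1 - b') 0) 1,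
      monomial (xyzExponent (σ 0 + 1) 0 (σ 2 + 1 - c')) 1} with hI
    have hfI : xyzBinomial k a b' c' ∈ I := Ideal.subset_span (by simp)
    conv_lhs => rw [hL]
    rw [Ideal.span_le]
    rintro p (rfl | ⟨e, he, rfl⟩)
    · exact hfI
    have heL : monomial e (1 : k) ∈ L := hL ▸ Ideal.subset_span (Or.inr ⟨e, he, rfl⟩)
    obtain ⟨v, hv, hva⟩ := ExponentCong.exists_lt (b' := b') (c' := c') ha e
    have hvL := (hv.monomial_mem_iff ha hfL).1 heL
    show monomial e (1 : k) ∈ I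
    rw [hv.monomial_mem_iff ha hfI]
    by_contra hvI
    have hnot (u : Fin 3 →₀ ℕ) (hu : monomial u (1 : k) ∈ I) : ¬ u ≤ v := fun h =>
      hvI (monomial_mem_of_le hu h)
    have h1 : v 1 ≤ σ 1 := by
      by_contra! h
      exact hnot _ (Ideal.subset_span (by simp)) (exponent_le (u := xyzExponent 0 (σ 1 + 1) 0)
        (by simp) (by simpa) (by simp))
    have h2 : v 2 ≤ σ 2 := by
      by_contra! h
      exact hnot _ (Ideal.subset_span (by simp)) (exponent_le (u := xyzExponent 0 0 (σ 2 + 1))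
        (by simp) (by simp) (by simpa))
    have h0 : σ 0 < v 0 := by
      by_contra! h
      exact hσ (monomial_mem_of_le hvL (exponent_le h h1 h2))
    have h3 : v 1 + b' ≤ σ 1 := by
      by_contra! h
      exact hnot _ (Ideal.subset_span (by simp))
        (exponent_le (u := xyzExponent (σ 0 + 1) (σ 1 + 1 - b') 0)
          (by simpa) (by simp; omega) (by simp))
    have h4 : v 2 + c' ≤ σ 2 := by
      by_contra! h
      exact hnot _ (Ideal.subset_span (by simp))
        (exponent_le (u := xyzExponent (σ 0 + 1) 0 (σ 2 + 1 - c'))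
          (by simpa) (by simp) (by simp; omega))
    -- Here `v` divides `x^(σ 0 + a) y^(σ 1 - b') z^(σ 2 - c')`, the representative of `σ` one
    -- period up.
    have hc : ExponentCong a b' c'
        (v + xyzExponent (σ 0 + a - v 0) (σ 1 - b' - v 1) (σ 2 - c' - v 2)) σ := by
      have e0 : v 0 + (σ 0 + a - v 0) = σ 0 + a := by omega
      have e1 : v 1 + (σ 1 - b' - v 1) + b' = σ 1 := by omega
      have e2 : v 2 + (σ 2 - c' - v 2) + c' = σ 2 := by omega
      refine ⟨?_, ?_, ?_⟩
      · simp [e0, Nat.ModEq]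
      · simp only [Finsupp.add_apply, xyzExponent_zero, xyzExponent_one, e0]
        conv_rhs => rw [← e1]
        ring
      · simp only [Finsupp.add_apply, xyzExponent_zero, xyzExponent_two, e0]
        conv_rhs => rw [← e2]
        ring
    exact hσ ((hc.monomial_mem_iff ha hfL).1 (monomial_mem_of_le hvL le_self_add))
  · rw [Ideal.span_le]
    rintro p (rfl | rfl | rfl | rfl | rfl)
    · exact hfL
    · by_contra hn
      obtain ⟨d, h0, h1, -⟩ := hdiv _ hn
      simp only [Finsupp.add_apply, xyzExponent_zero, xyzExponent_one, zero_add] at h0 h1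
      nlinarith [Nat.mul_le_mul_left b' (hmod _ h0)]
    · by_contra hn
      obtain ⟨d, h0, -, h1⟩ := hdiv _ hn
      simp only [Finsupp.add_apply, xyzExponent_zero, xyzExponent_two, zero_add] at h0 h1
      nlinarith [Nat.mul_le_mul_left c' (hmod _ h0)]
    · by_contra hn
      obtain ⟨d, h0, h1, -⟩ := hdiv _ hn
      simp only [Finsupp.add_apply, xyzExponent_zero, xyzExponent_one] at h0 h1
      have h2 := Nat.mul_le_mul_left b' (hmod' _ h0)
      have h3 : a * (σ 1 + 1) ≤ a * ((σ 1 + 1 - b') + b') := Nat.mul_le_mul_left a (by omega)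
      nlinarith
    · by_contra hn
      obtain ⟨d, h0, -, h1⟩ := hdiv _ hn
      simp only [Finsupp.add_apply, xyzExponent_zero, xyzExponent_two] at h0 h1
      have h2 := Nat.mul_le_mul_left c' (hmod' _ h0)
      have h3 : a * (σ 2 + 1) ≤ a * ((σ 2 + 1 - c') + c') := Nat.mul_le_mul_left a (by omega)
      nlinarith

/-- If either conclusion failed, `f` would be zero or have nonzero constant term. -/
theorem exponents_pos_of_mem_span_xyz (hf : xyzBinomial k a b' c' ≠ 0)
    (hfm : xyzBinomial k a b' c' ∈
      Ideal.span ({X 0, X 1, X 2} : Set (MvPolynomial (Fin 3) k))) :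
    0 < a ∧ (b' ≠ 0 ∨ c' ≠ 0) := by
  rw [span_xyz_eq_ker_constantCoeff, RingHom.mem_ker] at hfm
  simp only [xyzBinomial, map_sub, map_mul, map_pow, constantCoeff_X] at hfm hf
  rcases Nat.eq_zero_or_pos a with rfl | ha
  · by_cases h : b' = 0 ∧ c' = 0
    · simp [h.1, h.2] at hf
    · rcases not_and_or.1 h with h | h <;> simp [h] at hfm
  · refine ⟨ha, ?_⟩
    by_contra! h
    simp [h.1, h.2, ha.ne'] at hfm

end

theorem mainTheorem10 {k : Type u} [Field k] (a b' c' : ℕ)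
    (hf : xyzBinomial k a b' c' ≠ 0)
    (hfm : xyzBinomial k a b' c' ∈
      Ideal.span ({X 0, X 1, X 2} : Set (MvPolynomial (Fin 3) k)))
    (E : Finset (Fin 3 →₀ ℕ))
    (L : Ideal (MvPolynomial (Fin 3) k))
    (hL : L = Ideal.span
      ({xyzBinomial k a b' c'} ∪ (fun e => monomial e (1 : k)) '' (E : Set (Fin 3 →₀ ℕ))))
    (hht : L.height = 3)
    (hG : IsGorensteinIdeal L) :
    (∃ s : Finset (MvPolynomial (Fin 3) k),
      s.card ≤ 5 ∧ Ideal.span (s : Set (MvPolynomial (Fin 3) k)) = L) ∧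
    ∃ b c α β γ : ℕ,
      IsLeast {n : ℕ | (X 1 : MvPolynomial (Fin 3) k) ^ n ∈ L} b ∧
      IsLeast {n : ℕ | (X 2 : MvPolynomial (Fin 3) k) ^ n ∈ L} c ∧
      α < a ∧
      L = (idealJ k a b' c' b c).colon {xyzMonomial k α β γ} ∧
      L = fiveGenIdeal k a b' c' b c α β γ := by
  classical
  obtain ⟨ha, hbc⟩ := exponents_pos_of_mem_span_xyz hf hfm
  have hLtop : L ≠ ⊤ := by
    rintro rfl
    simp at hht
  have hy := exists_X_one_pow_mem hL hht ha.ne' hbc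
  have hz := exists_X_two_pow_mem hL hht ha.ne' hbc
  have hfL : xyzBinomial k a b' c' ∈ L := hL ▸ Ideal.subset_span (Or.inl rfl)
  have hrad := radical_eq_span_xyz hfL hLtop hbc hy hz
  obtain ⟨σ, hσa, hσ, hsoc, hdiv⟩ := exists_socle_monomial hL ha hLtop hrad hG
  have hfive := eq_span_of_socle_monomial hL hσa hσ hdiv
  obtain ⟨b, hb⟩ : ∃ b, IsLeast {n : ℕ | (X 1 : MvPolynomial (Fin 3) k) ^ n ∈ L} b :=
    ⟨_, Nat.isLeast_find hy⟩
  obtain ⟨c, hc⟩ : ∃ c, IsLeast {n : ℕ | (X 2 : MvPolynomial (Fin 3) k) ^ n ∈ L} c :=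
    ⟨_, Nat.isLeast_find hz⟩
  have hσb := lt_of_X_one_pow_mem hσ hb.1
  have hσc := lt_of_X_two_pow_mem hσ hc.1
  -- The colon exponents are the corner `(a - 1, b - 1, c - 1)` minus `σ`.
  refine ⟨⟨{xyzBinomial k a b' c', X 1 ^ (σ 1 + 1), X 2 ^ (σ 2 + 1),
      X 0 ^ (σ 0 + 1) * X 1 ^ (σ 1 + 1 - b'), X 0 ^ (σ 0 + 1) * X 2 ^ (σ 2 + 1 - c')},
      Finset.card_le_five, ?_⟩,
    b, c, a - 1 - σ 0, b - 1 - σ 1, c - 1 - σ 2, hb, hc, by omega,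
    eq_idealJ_colon hL hb.1 hc.1 hσa hσ hsoc, ?_⟩
  · rw [hfive]
    simp
  · rw [fiveGenIdeal, show a - (a - 1 - σ 0) = σ 0 + 1 by omega,
      show b - (b - 1 - σ 1) = σ 1 + 1 by omega, show c - (c - 1 - σ 2) = σ 2 + 1 by omega,
      show b - b' - (b - 1 - σ 1) = σ 1 + 1 - b' by omega,
      show c - c' - (c - 1 - σ 2) = σ 2 + 1 - c' by omega]
    exact hfive
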